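/- Let $L(z)=\sum_{i=2}^{d_v}L_iz^i$ and $R(z)=\sum_{i=1}^{d_c}R_iz^i$ be polynomials with non-negative real coefficients and $L(1)=R(1)=1$ (the node degree distributions of an irregular LDPC ensemble), and put $\lambda(z)=L'(z)/L'(1)$ and $\rho(z)=R'(z)/R'(1)$. Assume that the design rate $r=1-L'(1)/R'(1)$ is positive. For $x,\epsilon\in[0,1]$ let $f(x;\epsilon)=\epsilon\lambda(x)$, $g(x)=1-\rho(1-x)$, and $$U(x;\epsilon)=x\,g(x)-\int_0^x g(z)\,dz-\int_0^{g(x)}f(z;\epsilon)\,dz .$$ The potential threshold is $$\epsilon_c^*=\sup\Big\{\epsilon\in[0,1]\;:\;\max\big(\operatorname*{arg\,min}_{x\in[0,1]}U(x;\epsilon)\big)=0\Big\}.$$ For $x\in(0,1]$ let $\epsilon(x)=x/\lambda(1-\rho(1-x))$, and let $P(x)=\int_0^xL(1-\rho(1-z))\,\epsilon'(z)\,dz$ be the trial entropy, with $P(0)=0$. Let $\epsilon(0)=1/(\lambda'(0)\rho'(1))$, read as $+\infty$ if $\lambda'(0)=0$. The Maxwell threshold is $$\epsilon^{\mathrm{Max}}=\min\Big\{\epsilon(0),\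 \inf\{\epsilon(x) : x\in(0,1],\ P(x)=0\}\Big\},$$ where the infimum of the empty set is $+\infty$. Then the supremum defining $\epsilon_c^*$ is over a non-empty bounded set, $\epsilon^{\mathrm{Max}}=\min\{\epsilon(x) : x\in[0,1],\ P(x)=0\}$ with the minimum attained, and $$\epsilon_c^*=\epsilon^{\mathrm{Max}}.$$ Moreover, for every $\epsilon\in[0,1]$ with $\epsilon<\epsilon^{\mathrm{Max}}$ there is a finite $w_0$ such that for all $w>w_0$ and all $N\ge1$ the spatially coupled density evolution recursion on a binary erasure channel with erasure probability $\epsilon$, $$x_i^{(0)}=1,\qquad x_i^{(\ell+1)}=\sum_{j=1}^{N}A_{j,i}\,f\Big(\sum_{k=1}^{N+w-1}A_{j,k}\,g\big(x_k^{(\ell)}\big);\epsilon\Big)\qquad(1\le i\le N+w-1),$$ where $A_{j,k}=1/w$ if $1\le k-j+1\le w$ and $A_{j,k}=0$ otherwise, converges to the zero vector as $\ell\to\infty$. -/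

import Mathlib

open Set Filter Topology Polynomial

noncomputable section

/-! ### Scalar systems depending on a parameter, their potential, and spatial coupling -/

/-- The uncoupled potential
`U(x;ε) = x g(x;ε) - G(x;ε) - F(g(x;ε);ε)`, where `F` and `G` are the antiderivatives (in the
first variable, vanishing at `0`) of `f` and `g`. The second argument of `f`, `g` is `ε`. -/
def scalarPotential (f g : ℝ → ℝ → ℝ) (x ε : ℝ) : ℝ :=
  x * g x ε - (∫ z in (0 : ℝ)..x, g z ε) - ∫ z in (0 : ℝ)..(g x ε), f z ε

/-- The set of minimizers of `U(·;ε)` over `[0, xmax]`. -/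
def potentialMinimizers (f g : ℝ → ℝ → ℝ) (xmax ε : ℝ) : Set ℝ :=
  {x | x ∈ Icc 0 xmax ∧ ∀ z ∈ Icc 0 xmax, scalarPotential f g x ε ≤ scalarPotential f g z ε}

/-- The parameters `ε ∈ [0, εmax]` for which the largest minimizer of `U(·;ε)` is `0`. -/
def zeroMinimizerParameters (f g : ℝ → ℝ → ℝ) (xmax εmax : ℝ) : Set ℝ :=
  {ε | ε ∈ Icc 0 εmax ∧ IsGreatest (potentialMinimizers f g xmax ε) 0}

/-- The potential (or coupled) threshold: the supremum of those parameters. -/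
def potentialThreshold (f g : ℝ → ℝ → ℝ) (xmax εmax : ℝ) : ℝ :=
  sSup (zeroMinimizerParameters f g xmax εmax)

/-- The `N × (N + w - 1)` coupling matrix; with indices starting at `0`, its `(j, k)` entry is
`1 / w` if `j ≤ k ≤ j + w - 1` and `0` otherwise. -/
def couplingMatrix (N w : ℕ) : Matrix (Fin N) (Fin (N + w - 1)) ℝ :=
  fun j k => if (j : ℕ) ≤ k ∧ (k : ℕ) < j + w then 1 / (w : ℝ) else 0

/-- The coupled recursion
`x_i^(ℓ+1) = ∑_j A_{j,i} f(∑_k A_{j,k} g(x_k^(ℓ)))`, started at `x_i^(0) = xmax`. -/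
def coupledRecursion (f g : ℝ → ℝ) (xmax : ℝ) (N w : ℕ) : ℕ → Fin (N + w - 1) → ℝ
  | 0 => fun _ => xmax
  | ℓ + 1 => fun i => ∑ j, couplingMatrix N w j i *
      f (∑ k, couplingMatrix N w j k * g (coupledRecursion f g xmax N w ℓ k))

/-! ### Irregular LDPC ensembles on the binary erasure channel -/

/-- The node-perspective degree distributions `L(z) = ∑_{i ≥ 2} L_i z^i` of the variable nodes
and `R(z) = ∑_{i ≥ 1} R_i z^i` of the check nodes of an irregular LDPC ensemble. -/
structure LDPCEnsemble where
  /-- variable-node degree distribution -/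
  L : ℝ[X]
  /-- check-node degree distribution -/
  R : ℝ[X]
  L_nonneg : ∀ i, 0 ≤ L.coeff i
  R_nonneg : ∀ i, 0 ≤ R.coeff i
  L_sum : L.eval 1 = 1
  R_sum : R.eval 1 = 1
  L_coeff_zero : L.coeff 0 = 0
  L_coeff_one : L.coeff 1 = 0
  R_coeff_zero : R.coeff 0 = 0

namespace LDPCEnsemble

variable (E : LDPCEnsemble)

/-- Variable-side edge degree distribution `λ(z) = L'(z) / L'(1)`. -/
def lam : ℝ[X] := C (E.L.derivative.eval 1)⁻¹ * E.L.derivative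

/-- Check-side edge degree distribution `ρ(z) = R'(z) / R'(1)`. -/
def rho : ℝ[X] := C (E.R.derivative.eval 1)⁻¹ * E.R.derivative

/-- Design rate `r = 1 - L'(1) / R'(1)`. -/
def designRate : ℝ := 1 - E.L.derivative.eval 1 / E.R.derivative.eval 1

/-- `f(x;ε) = ε λ(x)`. -/
def f (x ε : ℝ) : ℝ := ε * E.lam.eval x

/-- `g(x;ε) = 1 - ρ(1 - x)`, which does not depend on `ε`. -/
def g (x _ε : ℝ) : ℝ := 1 - E.rho.eval (1 - x)

/-- For `x ∈ (0,1]`, the parameter `ε(x) = x / λ(1 - ρ(1 - x))` that supports a fixed point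
of density evolution at `x`. -/
def fixedPointParameter (x : ℝ) : ℝ := x / E.lam.eval (1 - E.rho.eval (1 - x))

/-- The stability value `ε(0) = lim_{x → 0} ε(x)`: it is `1 / (λ'(0) ρ'(1))`, read as `∞` when
the denominator vanishes. -/
def stabilityValue : EReal :=
  if 0 < E.lam.derivative.eval 0 * E.rho.derivative.eval 1 then
    ((1 / (E.lam.derivative.eval 0 * E.rho.derivative.eval 1) : ℝ) : EReal)
  else ⊤

/-- `ε(x)` on all of `[0,1]`, with the (possibly infinite) limiting value at `x = 0`. -/
def extendedParameter (x : ℝ) : EReal :=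
  if x = 0 then E.stabilityValue else (E.fixedPointParameter x : EReal)

/-- The trial entropy `P(x) = ∫_0^x L(1 - ρ(1 - z)) ε'(z) dz`. -/
def trialEntropy (x : ℝ) : ℝ :=
  ∫ z in (0 : ℝ)..x, E.L.eval (1 - E.rho.eval (1 - z)) * deriv E.fixedPointParameter z

/-- The Maxwell threshold
`min { 1 / (λ'(0) ρ'(1)), min { ε(x) | P(x) = 0, x ∈ (0,1] } }`, valued in the extended reals. -/
def maxwellThreshold : EReal :=
  min E.stabilityValue
    (sInf {e : EReal | ∃ x ∈ Ioc (0 : ℝ) 1, E.trialEntropy x = 0 ∧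
      e = (E.fixedPointParameter x : EReal)})

/-- The values `ε(x)` at the zeros `x ∈ [0,1]` of the trial entropy. -/
def maxwellCandidates : Set EReal :=
  {e | ∃ x ∈ Icc (0 : ℝ) 1, E.trialEntropy x = 0 ∧ e = E.extendedParameter x}

/-- The potential threshold of the ensemble, for `xmax = εmax = 1`. -/
def epsC : ℝ := potentialThreshold E.f E.g 1 1

/-- The density evolution recursion of the spatially coupled ensemble at erasure
probability `ε`. -/
def coupledDE (ε : ℝ) (N w : ℕ) : ℕ → Fin (N + w - 1) → ℝ :=
  coupledRecursion (fun x => E.f x ε) (fun x => E.g x ε) 1 N w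

end LDPCEnsemble

end

/-! ### The coupled recursion on the half line -/

/-! Integrating in closed form gives U(x;ε) = C(x) - ε V(g(x)), with C = `checkEnergy` and V =
`varEnergy`. Everything is read off from the energy ratio Q = V(g)/C, extended to 0 by its limit
λ'(0)ρ'(1) (`energyRatio`). Since U(0;ε) = 0, the largest minimizer is 0 exactly when ε Q < 1 on
(0,1], so the potential threshold is 1 / max Q.

The trial entropy satisfies P(x) = -L'(1) U(x;ε(x)) (`trialEntropy_eq`), so for x > 0 it vanishes
iff ε(x) = 1/Q(x). The same equation, cleared of denominators, is the vanishing of the numerator of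
Q'. Hence every zero of P has ε(x) = 1/Q(x) ≥ 1 / max Q, and a maximizer of Q in (0,1) is a zero of
P. A maximizer at 0 gives the stability value. The endpoint 1 is ruled out by the positive rate,
which also forces max Q > 1, so that 1 / max Q lies inside the allowed range of ε. Thus both
thresholds equal 1 / max Q.

For saturation, the coupled recursion is dominated by one on the half line, whose limit is a fixed
point nondecreasing in position, with some limiting value X. The fixed-point equation turns a
Stieltjes sum for ∫ x dg into one for ∫ f(y) dy, where y is the averaged profile of g. Averaging
over w positions makes the jumps of y at most g(X)/w, so U(X;ε) ≤ g(X) f(g(X))/w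
(`potential_le_of_halfLineStep_eq`). Because y λ(y) ≤ deg(L) V(y), this error only amounts to
replacing ε by ε(1 + deg(L)/w), uniformly in X down to 0. If that value still lies below 1 / max Q,
then X = 0. -/

/-- One step of the coupled recursion on the half line, without a right boundary. -/
noncomputable def halfLineStep (f g : ℝ → ℝ) (w : ℕ) (u : ℕ → ℝ) (i : ℕ) : ℝ :=
  1 / (w : ℝ) * ∑ k ∈ Finset.range w, if k ≤ i then
    f (1 / (w : ℝ) * ∑ m ∈ Finset.range w, g (u (i - k + m))) else 0

/-- The coupled recursion on the half line, started at `1`. -/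
noncomputable def halfLineRecursion (f g : ℝ → ℝ) (w : ℕ) : ℕ → ℕ → ℝ
  | 0 => fun _ => 1
  | ℓ + 1 => halfLineStep f g w (halfLineRecursion f g w ℓ)

lemma average_mem_Icc {w : ℕ} {a : ℕ → ℝ} (ha : ∀ m, a m ∈ Icc (0 : ℝ) 1) :
    1 / (w : ℝ) * ∑ m ∈ Finset.range w, a m ∈ Icc (0 : ℝ) 1 := by
  constructor
  · exact mul_nonneg (by positivity) (Finset.sum_nonneg fun m _ => (ha m).1)
  · rcases Nat.eq_zero_or_pos w with rfl | hw
    · simp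
    · have hw' : (0 : ℝ) < w := by exact_mod_cast hw
      have : ∑ m ∈ Finset.range w, a m ≤ w := by
        simpa using Finset.sum_le_sum fun m (_ : m ∈ Finset.range w) => (ha m).2
      rw [one_div, inv_mul_le_iff₀ hw']
      simpa using this

lemma average_le_average {w : ℕ} {a b : ℕ → ℝ} (h : ∀ m, a m ≤ b m) :
    1 / (w : ℝ) * ∑ m ∈ Finset.range w, a m ≤ 1 / (w : ℝ) * ∑ m ∈ Finset.range w, b m :=
  mul_le_mul_of_nonneg_left (Finset.sum_le_sum fun m _ => h m) (by positivity)

section HalfLine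

variable {f g : ℝ → ℝ} {w : ℕ}

lemma halfLineStep_mem_Icc (hf : MapsTo f (Icc 0 1) (Icc 0 1)) (hg : MapsTo g (Icc 0 1) (Icc 0 1))
    {u : ℕ → ℝ} (hu : ∀ i, u i ∈ Icc (0 : ℝ) 1) (i : ℕ) :
    halfLineStep f g w u i ∈ Icc (0 : ℝ) 1 := by
  refine average_mem_Icc fun k => ?_
  split_ifs
  · exact hf (average_mem_Icc fun m => hg (hu _))
  · simp

lemma halfLineStep_le_halfLineStep (hg : MapsTo g (Icc 0 1) (Icc 0 1))
    (hfm : MonotoneOn f (Icc 0 1)) (hgm : MonotoneOn g (Icc 0 1))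
    {u v : ℕ → ℝ} (hu : ∀ i, u i ∈ Icc (0 : ℝ) 1) (hv : ∀ i, v i ∈ Icc (0 : ℝ) 1)
    (huv : ∀ i, u i ≤ v i) (i : ℕ) : halfLineStep f g w u i ≤ halfLineStep f g w v i := by
  refine average_le_average fun k => ?_
  split_ifs
  · exact hfm (average_mem_Icc fun m => hg (hu _)) (average_mem_Icc fun m => hg (hv _))
      (average_le_average fun m => hgm (hu _) (hv _) (huv _))
  · exact le_rfl

/-- A step to the right moves every window to larger values, and a term cut off by the left boundary
can only be replaced by a nonnegative one. -/
lemma monotone_halfLineStep (hf : MapsTo f (Icc 0 1) (Icc 0 1)) (hg : MapsTo g (Icc 0 1) (Icc 0 1))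
    (hfm : MonotoneOn f (Icc 0 1)) (hgm : MonotoneOn g (Icc 0 1))
    {u : ℕ → ℝ} (hu : ∀ i, u i ∈ Icc (0 : ℝ) 1) (hum : Monotone u) :
    Monotone (halfLineStep f g w u) := by
  refine monotone_nat_of_le_succ fun i => average_le_average fun k => ?_
  by_cases hk : k ≤ i
  · rw [if_pos hk, if_pos (by omega)]
    exact hfm (average_mem_Icc fun m => hg (hu _)) (average_mem_Icc fun m => hg (hu _))
      (average_le_average fun m => hgm (hu _) (hu _) (hum (by omega)))
  · rw [if_neg hk]
    split_ifs
    · exact (hf (average_mem_Icc fun m => hg (hu _))).1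
    · exact le_rfl

lemma halfLineRecursion_mem_Icc (hf : MapsTo f (Icc 0 1) (Icc 0 1))
    (hg : MapsTo g (Icc 0 1) (Icc 0 1)) (ℓ i : ℕ) :
    halfLineRecursion f g w ℓ i ∈ Icc (0 : ℝ) 1 := by
  induction ℓ generalizing i with
  | zero => simp [halfLineRecursion]
  | succ ℓ ih => exact halfLineStep_mem_Icc hf hg ih i

lemma monotone_halfLineRecursion (hf : MapsTo f (Icc 0 1) (Icc 0 1))
    (hg : MapsTo g (Icc 0 1) (Icc 0 1)) (hfm : MonotoneOn f (Icc 0 1))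
    (hgm : MonotoneOn g (Icc 0 1)) (ℓ : ℕ) : Monotone (halfLineRecursion f g w ℓ) := by
  induction ℓ with
  | zero => exact monotone_const
  | succ ℓ ih =>
    exact monotone_halfLineStep hf hg hfm hgm (halfLineRecursion_mem_Icc hf hg ℓ) ih

lemma antitone_halfLineRecursion (hf : MapsTo f (Icc 0 1) (Icc 0 1))
    (hg : MapsTo g (Icc 0 1) (Icc 0 1)) (hfm : MonotoneOn f (Icc 0 1))
    (hgm : MonotoneOn g (Icc 0 1)) (i : ℕ) :
    Antitone fun ℓ => halfLineRecursion f g w ℓ i := by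
  refine antitone_nat_of_succ_le fun ℓ => ?_
  induction ℓ generalizing i with
  | zero => exact (halfLineRecursion_mem_Icc hf hg 1 i).2
  | succ ℓ ih =>
    exact halfLineStep_le_halfLineStep hg hfm hgm (halfLineRecursion_mem_Icc hf hg _)
      (halfLineRecursion_mem_Icc hf hg _) ih i

/-- The half-line recursion decreases to a monotone fixed point. -/
lemma exists_tendsto_halfLineRecursion (hf : MapsTo f (Icc 0 1) (Icc 0 1))
    (hg : MapsTo g (Icc 0 1) (Icc 0 1)) (hfm : MonotoneOn f (Icc 0 1))
    (hgm : MonotoneOn g (Icc 0 1)) (hfc : Continuous f) (hgc : Continuous g) :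
    ∃ x : ℕ → ℝ, (∀ i, x i ∈ Icc (0 : ℝ) 1) ∧ Monotone x ∧ halfLineStep f g w x = x ∧
      ∀ i, Tendsto (fun ℓ => halfLineRecursion f g w ℓ i) atTop (𝓝 (x i)) := by
  have hlim (i : ℕ) : Tendsto (fun ℓ => halfLineRecursion f g w ℓ i) atTop
      (𝓝 (⨅ ℓ, halfLineRecursion f g w ℓ i)) :=
    tendsto_atTop_ciInf (antitone_halfLineRecursion hf hg hfm hgm i)
      ⟨0, by rintro _ ⟨ℓ, rfl⟩; exact (halfLineRecursion_mem_Icc hf hg ℓ i).1⟩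
  refine ⟨fun i => ⨅ ℓ, halfLineRecursion f g w ℓ i, fun i => ?_, fun i j hij => ?_, ?_, hlim⟩
  · exact isClosed_Icc.mem_of_tendsto (hlim i)
      (Eventually.of_forall fun ℓ => halfLineRecursion_mem_Icc hf hg ℓ i)
  · exact le_of_tendsto_of_tendsto' (hlim i) (hlim j)
      fun ℓ => monotone_halfLineRecursion hf hg hfm hgm ℓ hij
  · funext i
    refine tendsto_nhds_unique ?_ ((tendsto_add_atTop_iff_nat 1).2 (hlim i))
    refine Tendsto.const_mul _ (tendsto_finsetSum _ fun k _ => ?_)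
    split_ifs
    · exact (hfc.tendsto _).comp (Tendsto.const_mul _ (tendsto_finsetSum _ fun m _ =>
        (hgc.tendsto _).comp (hlim _)))
    · exact tendsto_const_nhds

/-- Substitute i = j + k after extending the left sum to k + M terms, all nonnegative. This moves
the averaging from one factor to the other, as a transpose. -/
lemma sum_shift_le {a d : ℕ → ℝ} (ha : ∀ i, 0 ≤ a i) (hd : ∀ i, 0 ≤ d i) (k M : ℕ) :
    ∑ i ∈ Finset.range M, (if k ≤ i then a (i - k) else 0) * d i ≤
      ∑ j ∈ Finset.range M, a j * d (j + k) := by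
  calc _ ≤ ∑ i ∈ Finset.range (k + M), (if k ≤ i then a (i - k) else 0) * d i := by
        refine Finset.sum_le_sum_of_subset_of_nonneg
          (Finset.range_mono (Nat.le_add_left _ _)) fun i _ _ => mul_nonneg ?_ (hd i)
        split_ifs
        · exact ha _
        · exact le_rfl
    _ = _ := by
        rw [Finset.sum_range_add, Finset.sum_eq_zero, zero_add]
        · refine Finset.sum_congr rfl fun j _ => ?_
          rw [if_pos (Nat.le_add_right _ _), Nat.add_sub_cancel_left, add_comm k j]
        · intro i hi
          rw [if_neg (by simpa using hi), zero_mul]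

lemma mul_sub_le_integral {h : ℝ → ℝ} (hm : MonotoneOn h (Icc 0 1)) (hc : Continuous h) {a b : ℝ}
    (ha : 0 ≤ a) (hab : a ≤ b) (hb : b ≤ 1) : h a * (b - a) ≤ ∫ z in a..b, h z := by
  have := intervalIntegral.integral_mono_on hab (μ := MeasureTheory.volume)
    (f := fun _ => h a) (g := h) (by simp) (hc.intervalIntegrable _ _)
    fun z hz => hm ⟨ha, hab.trans hb⟩ ⟨ha.trans hz.1, hz.2.trans hb⟩ hz.1
  simpa [mul_comm] using this

/-- The potential of the limiting value of a monotone fixed point of the half-line recursion is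
at most of order `1 / w`. -/
lemma potential_le_of_halfLineStep_eq (hw : 0 < w) (hf : MapsTo f (Icc 0 1) (Icc 0 1))
    (hg : MapsTo g (Icc 0 1) (Icc 0 1)) (hfm : MonotoneOn f (Icc 0 1))
    (hgm : MonotoneOn g (Icc 0 1)) (hfc : Continuous f) (hgc : Continuous g)
    {x : ℕ → ℝ} (hx : ∀ i, x i ∈ Icc (0 : ℝ) 1) (hxm : Monotone x)
    (hfix : halfLineStep f g w x = x) {X : ℝ} (hX : Tendsto x atTop (𝓝 X)) :
    X * g X - ∫ z in (0 : ℝ)..X, g z ≤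
      (∫ z in (0 : ℝ)..(g X), f z) + g X * f (g X) / w := by
  have hw' : (0 : ℝ) < w := by exact_mod_cast hw
  have hX1 : X ∈ Icc (0 : ℝ) 1 := isClosed_Icc.mem_of_tendsto hX (Eventually.of_forall hx)
  have hxX (i : ℕ) : x i ≤ X := hxm.ge_of_tendsto hX i
  -- the sequence, with a zero put in front
  obtain ⟨t, ht0, hts⟩ : ∃ t : ℕ → ℝ, t 0 = 0 ∧ ∀ i, t (i + 1) = x i :=
    ⟨fun n => Nat.casesOn n 0 x, rfl, fun i => rfl⟩
  have htI (i : ℕ) : t i ∈ Icc (0 : ℝ) 1 := by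
    cases i with
    | zero => simp [ht0]
    | succ i => rw [hts]; exact hx i
  have htX (i : ℕ) : t i ≤ X := by
    cases i with
    | zero => rw [ht0]; exact hX1.1
    | succ i => rw [hts]; exact hxX i
  have htm : Monotone t := by
    refine monotone_nat_of_le_succ fun i => ?_
    cases i with
    | zero => rw [ht0]; exact (htI 1).1
    | succ i => rw [hts, hts]; exact hxm (Nat.le_succ i)
  set v : ℕ → ℝ := fun i => g (t i) with hv
  have hvI (i : ℕ) : v i ∈ Icc (0 : ℝ) 1 := hg (htI i)
  have hvm : Monotone v := fun i j hij => hgm (htI i) (htI j) (htm hij)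
  have hvX (i : ℕ) : v i ≤ g X := hgm (htI i) hX1 (htX i)
  set Y : ℕ → ℝ := fun j => 1 / (w : ℝ) * ∑ m ∈ Finset.range w, v (j + m) with hY
  have hYI (j : ℕ) : Y j ∈ Icc (0 : ℝ) 1 := average_mem_Icc fun m => hvI _
  have hYm : Monotone Y := fun i j hij => average_le_average fun m => hvm (by omega)
  have hYd (j : ℕ) : Y (j + 1) - Y j =
      1 / w * ∑ m ∈ Finset.range w, (v (j + m + 1) - v (j + m)) := by
    simp only [hY]
    rw [← mul_sub, ← Finset.sum_sub_distrib]
    simp only [add_right_comm]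
  -- The difference of two neighbouring averages telescopes to (v (j+w) - v j)/w. This is the only
  -- source of the factor 1/w.
  have hYd' (j : ℕ) : Y (j + 1) - Y j ≤ g X / w := by
    have hs : ∑ m ∈ Finset.range w, (v (j + m + 1) - v (j + m)) = v (j + w) - v (j + 0) :=
      Finset.sum_range_sub (fun m => v (j + m)) w
    rw [hYd, hs, one_div, inv_mul_eq_div]
    have := hvX (j + w)
    have := (hvI (j + 0)).1
    gcongr
    linarith
  have hYX (j : ℕ) : Y j ≤ g X := by
    have h := average_le_average (w := w) (b := fun _ => g X) fun m => hvX (j + m)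
    simpa [hY, hw'.ne'] using h
  -- Insert the fixed-point equation for t and move the outer average onto the increments of v,
  -- where it produces the increments of Y.
  have hexch (M : ℕ) : ∑ i ∈ Finset.range M, t (i + 1) * (v (i + 1) - v i) ≤
      ∑ j ∈ Finset.range M, f (Y (j + 1)) * (Y (j + 1) - Y j) := by
    have hstep (i : ℕ) : t (i + 1) = 1 / (w : ℝ) * ∑ k ∈ Finset.range w,
        if k ≤ i then f (Y (i - k + 1)) else 0 := by
      rw [hts, ← congrFun hfix i, halfLineStep]
      simp only [hY, hv, add_right_comm _ 1, hts]
    calc ∑ i ∈ Finset.range M, t (i + 1) * (v (i + 1) - v i)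
        = 1 / w * ∑ k ∈ Finset.range w, ∑ i ∈ Finset.range M,
          (if k ≤ i then f (Y (i - k + 1)) else 0) * (v (i + 1) - v i) := by
          rw [Finset.sum_comm, Finset.mul_sum]
          refine Finset.sum_congr rfl fun i _ => ?_
          rw [hstep, mul_assoc, Finset.sum_mul]
      _ ≤ 1 / w * ∑ k ∈ Finset.range w, ∑ j ∈ Finset.range M,
          f (Y (j + 1)) * (v (j + k + 1) - v (j + k)) := by
          refine average_le_average fun k => ?_
          exact sum_shift_le (a := fun i => f (Y (i + 1))) (d := fun i => v (i + 1) - v i)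
            (fun i => (hf (hYI _)).1) (fun i => sub_nonneg.2 (hvm (Nat.le_succ i))) k M
      _ = _ := by
          rw [Finset.sum_comm, Finset.mul_sum]
          refine Finset.sum_congr rfl fun j _ => ?_
          rw [hYd, ← Finset.mul_sum]
          ring
  have hI (h : ℝ → ℝ) (hc : Continuous h) (a b : ℝ) :
      (∫ z in (0 : ℝ)..b, h z) - ∫ z in (0 : ℝ)..a, h z = ∫ z in a..b, h z :=
    intervalIntegral.integral_interval_sub_left (hc.intervalIntegrable _ _)
      (hc.intervalIntegrable _ _)
  -- The left side is ∫ t dg, integrated by parts, and the right side is its upper Stieltjes sum.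
  -- Each increment reduces to g(t)(t' - t) ≤ ∫ g over [t, t'].
  have hlow (M : ℕ) : t M * g (t M) - ∫ z in (0 : ℝ)..(t M), g z ≤
      ∑ i ∈ Finset.range M, t (i + 1) * (v (i + 1) - v i) := by
    induction M with
    | zero => simp [ht0]
    | succ M ih =>
      rw [Finset.sum_range_succ]
      have h1 := hI g hgc (t M) (t (M + 1))
      have h2 := mul_sub_le_integral hgm hgc (htI M).1 (htm (Nat.le_succ M)) (htI (M + 1)).2
      simp only [hv] at ih ⊢
      simp only [Nat.succ_eq_add_one] at h2
      linarith
  -- A right-endpoint rectangle exceeds the integral by at most its width times the increment of f.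
  -- The widths are at most g(X)/w and the increments of f telescope.
  have hup (M : ℕ) : ∑ j ∈ Finset.range M, f (Y (j + 1)) * (Y (j + 1) - Y j) ≤
      (∫ z in (0 : ℝ)..(Y M), f z) - (∫ z in (0 : ℝ)..(Y 0), f z) +
        g X / w * (f (Y M) - f (Y 0)) := by
    induction M with
    | zero => simp
    | succ M ih =>
      rw [Finset.sum_range_succ]
      have h1 := hI f hfc (Y M) (Y (M + 1))
      have h2 := mul_sub_le_integral hfm hfc (hYI M).1 (hYm (Nat.le_succ M)) (hYI (M + 1)).2
      have h3 : (Y (M + 1) - Y M) * (f (Y (M + 1)) - f (Y M)) ≤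
          g X / w * (f (Y (M + 1)) - f (Y M)) :=
        mul_le_mul_of_nonneg_right (hYd' M)
          (sub_nonneg.2 (hfm (hYI M) (hYI _) (hYm (Nat.le_succ M))))
      simp only [Nat.succ_eq_add_one] at h2
      linarith
  have hbound (M : ℕ) : t M * g (t M) - ∫ z in (0 : ℝ)..(t M), g z ≤
      (∫ z in (0 : ℝ)..(g X), f z) + g X * f (g X) / w := by
    refine ((hlow M).trans (hexch M)).trans ((hup M).trans ?_)
    have hgX := hg hX1
    have hpos {a b : ℝ} (ha : 0 ≤ a) (hab : a ≤ b) (hb : b ≤ 1) : 0 ≤ ∫ z in a..b, f z :=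
      intervalIntegral.integral_nonneg hab fun z hz => (hf ⟨ha.trans hz.1, hz.2.trans hb⟩).1
    have h1 := hpos le_rfl (hYI 0).1 (hYI 0).2
    have h2 := hpos (hYI M).1 (hYX M) hgX.2
    rw [← hI f hfc] at h2
    have h3 : g X / w * (f (Y M) - f (Y 0)) ≤ g X / w * f (g X) := by
      have := hfm (hYI M) hgX (hYX M)
      have := (hf (hYI 0)).1
      exact mul_le_mul_of_nonneg_left (by linarith) (div_nonneg hgX.1 hw'.le)
    have h4 : g X * f (g X) / w = g X / w * f (g X) := by ring
    linarith
  have htlim : Tendsto t atTop (𝓝 X) := by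
    rw [← tendsto_add_atTop_iff_nat 1]
    simpa only [hts] using hX
  have hcont : Continuous fun s : ℝ => s * g s - ∫ z in (0 : ℝ)..s, g z :=
    (continuous_id.mul hgc).sub
      (intervalIntegral.continuous_primitive (fun a b => hgc.intervalIntegrable a b) 0)
  exact le_of_tendsto' ((hcont.tendsto X).comp htlim) hbound

/-- The half-line recursion converges to zero if the potential exceeds `g(X) f(g(X)) / w` for
every `X ∈ (0,1]`. -/
lemma tendsto_halfLineRecursion_zero (hw : 0 < w) (hf : MapsTo f (Icc 0 1) (Icc 0 1))
    (hg : MapsTo g (Icc 0 1) (Icc 0 1)) (hfm : MonotoneOn f (Icc 0 1))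
    (hgm : MonotoneOn g (Icc 0 1)) (hfc : Continuous f) (hgc : Continuous g)
    (hU : ∀ X ∈ Ioc (0 : ℝ) 1, (∫ z in (0 : ℝ)..(g X), f z) + g X * f (g X) / w <
      X * g X - ∫ z in (0 : ℝ)..X, g z) (i : ℕ) :
    Tendsto (fun ℓ => halfLineRecursion f g w ℓ i) atTop (𝓝 0) := by
  obtain ⟨x, hx, hxm, hfix, hlim⟩ :=
    exists_tendsto_halfLineRecursion (w := w) hf hg hfm hgm hfc hgc
  have hX := tendsto_atTop_ciSup hxm ⟨1, by rintro _ ⟨i, rfl⟩; exact (hx i).2⟩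
  have hX1 := isClosed_Icc.mem_of_tendsto hX (Eventually.of_forall hx)
  have hle := potential_le_of_halfLineStep_eq hw hf hg hfm hgm hfc hgc hx hxm hfix hX
  have hX0 : (⨆ i, x i) = 0 := by
    by_contra hne
    exact (hU _ ⟨lt_of_le_of_ne hX1.1 (Ne.symm hne), hX1.2⟩).not_ge hle
  have : x i = 0 := le_antisymm (hX0 ▸ hxm.ge_of_tendsto hX i) (hx i).1
  exact this ▸ hlim i

end HalfLine

/-! ### Comparison of the coupled recursion with the half line -/

lemma couplingMatrix_nonneg (N w : ℕ) (j : Fin N) (k : Fin (N + w - 1)) :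
    0 ≤ couplingMatrix N w j k := by
  unfold couplingMatrix
  split_ifs
  · positivity
  · exact le_rfl

lemma sum_couplingMatrix_mul_le (N w : ℕ) (j : Fin N) {a : ℕ → ℝ} (ha : ∀ k, 0 ≤ a k) :
    ∑ k, couplingMatrix N w j k * a k ≤
      1 / (w : ℝ) * ∑ m ∈ Finset.range w, a (j + m) := by
  calc ∑ k, couplingMatrix N w j k * a k
      = ∑ k ∈ Finset.range (N + w - 1),
          (if (j : ℕ) ≤ k ∧ k < j + w then 1 / (w : ℝ) * a k else 0) := by
        rw [Finset.sum_range]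
        simp only [couplingMatrix, ite_mul, zero_mul]
    _ ≤ ∑ k ∈ Finset.Ico (j : ℕ) (j + w), 1 / (w : ℝ) * a k := by
        rw [← Finset.sum_filter]
        refine Finset.sum_le_sum_of_subset_of_nonneg (fun k hk => ?_)
          fun k _ _ => mul_nonneg (by positivity) (ha k)
        simpa using (Finset.mem_filter.1 hk).2
    _ = _ := by
        rw [Finset.sum_Ico_eq_sum_range, Nat.add_sub_cancel_left, Finset.mul_sum]

/-- Reindexing j as i - k identifies the left side with the part of the right side having i - k < N.
The terms beyond the right boundary are nonnegative. -/
lemma sum_couplingMatrix_transpose_mul_le (N w : ℕ) (i : Fin (N + w - 1)) {b : ℕ → ℝ}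
    (hb : ∀ j, 0 ≤ b j) :
    ∑ j, couplingMatrix N w j i * b j ≤
      1 / (w : ℝ) * ∑ k ∈ Finset.range w, if k ≤ (i : ℕ) then b (i - k) else 0 := by
  calc ∑ j, couplingMatrix N w j i * b j
      = ∑ j ∈ Finset.range N,
          (if j ≤ (i : ℕ) ∧ (i : ℕ) < j + w then 1 / (w : ℝ) * b j else 0) := by
        rw [Finset.sum_range]
        simp only [couplingMatrix, ite_mul, zero_mul]
    _ ≤ ∑ j ∈ (Finset.range w).filter (· ≤ (i : ℕ)), 1 / (w : ℝ) * b (i - j) := by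
        rw [← Finset.sum_filter]
        rw [← Finset.sum_image (s := (Finset.range w).filter (· ≤ (i : ℕ)))
          (g := fun j => (i : ℕ) - j) (f := fun j => 1 / (w : ℝ) * b j)]
        · refine Finset.sum_le_sum_of_subset_of_nonneg (fun j hj => ?_)
            fun j _ _ => mul_nonneg (by positivity) (hb j)
          simp only [Finset.mem_filter, Finset.mem_range, Finset.mem_image] at hj ⊢
          exact ⟨i - j, by omega, by omega⟩
        · intro j hj k hk h
          simp only [Finset.coe_filter, Finset.mem_range, Set.mem_ofPred_eq] at hj hk h
          omega
    _ = _ := by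
        rw [Finset.sum_filter, Finset.mul_sum]
        simp only [mul_ite, mul_zero]

/-- Both matrix sums grow when the right boundary is removed, and f and g are monotone, so the
domination propagates by induction. -/
lemma coupledRecursion_mem_Icc {f g : ℝ → ℝ} {N w : ℕ}
    (hf : MapsTo f (Icc 0 1) (Icc 0 1)) (hg : MapsTo g (Icc 0 1) (Icc 0 1))
    (hfm : MonotoneOn f (Icc 0 1)) (hgm : MonotoneOn g (Icc 0 1)) (ℓ : ℕ)
    (i : Fin (N + w - 1)) :
    coupledRecursion f g 1 N w ℓ i ∈ Icc 0 (halfLineRecursion f g w ℓ i) := by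
  induction ℓ generalizing i with
  | zero => simp [coupledRecursion, halfLineRecursion]
  | succ ℓ ih =>
    have hu := halfLineRecursion_mem_Icc (w := w) hf hg ℓ
    have hI (k : Fin (N + w - 1)) : coupledRecursion f g 1 N w ℓ k ∈ Icc (0 : ℝ) 1 :=
      ⟨(ih k).1, (ih k).2.trans (hu k).2⟩
    have h0 (j : Fin N) :
        0 ≤ ∑ k, couplingMatrix N w j k * g (coupledRecursion f g 1 N w ℓ k) :=
      Finset.sum_nonneg fun k _ => mul_nonneg (couplingMatrix_nonneg _ _ _ _) (hg (hI k)).1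
    have h1 (j : Fin N) : ∑ k, couplingMatrix N w j k * g (coupledRecursion f g 1 N w ℓ k) ≤
        1 / (w : ℝ) * ∑ m ∈ Finset.range w, g (halfLineRecursion f g w ℓ (j + m)) := by
      refine le_trans (Finset.sum_le_sum fun k _ => mul_le_mul_of_nonneg_left
        (hgm (hI k) (hu k) (ih k).2) (couplingMatrix_nonneg _ _ _ _)) ?_
      exact sum_couplingMatrix_mul_le N w j fun k => (hg (hu k)).1
    have hA (j : ℕ) : 1 / (w : ℝ) * ∑ m ∈ Finset.range w,
        g (halfLineRecursion f g w ℓ (j + m)) ∈ Icc (0 : ℝ) 1 :=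
      average_mem_Icc fun m => hg (hu _)
    constructor
    · exact Finset.sum_nonneg fun j _ => mul_nonneg (couplingMatrix_nonneg _ _ _ _)
        (hf ⟨h0 j, (h1 j).trans (hA j).2⟩).1
    · refine le_trans (Finset.sum_le_sum fun j _ => mul_le_mul_of_nonneg_left
        (hfm ⟨h0 j, (h1 j).trans (hA j).2⟩ (hA j) (h1 j)) (couplingMatrix_nonneg _ _ _ _)) ?_
      exact sum_couplingMatrix_transpose_mul_le N w i
        (b := fun j => f (1 / (w : ℝ) * ∑ m ∈ Finset.range w,
          g (halfLineRecursion f g w ℓ (j + m)))) fun j => (hf (hA j)).1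

/-- Saturation for scalar recursions: if the potential exceeds `g(X) f(g(X)) / w` for every
`X ∈ (0,1]`, then the recursion with coupling width `w` converges to zero for every length. -/
theorem tendsto_coupledRecursion_zero {f g : ℝ → ℝ} {w : ℕ} (hw : 0 < w)
    (hf : MapsTo f (Icc 0 1) (Icc 0 1)) (hg : MapsTo g (Icc 0 1) (Icc 0 1))
    (hfm : MonotoneOn f (Icc 0 1)) (hgm : MonotoneOn g (Icc 0 1)) (hfc : Continuous f)
    (hgc : Continuous g)
    (hU : ∀ X ∈ Ioc (0 : ℝ) 1, (∫ z in (0 : ℝ)..(g X), f z) + g X * f (g X) / w <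
      X * g X - ∫ z in (0 : ℝ)..X, g z) (N : ℕ) :
    Tendsto (fun ℓ => coupledRecursion f g 1 N w ℓ) atTop (𝓝 0) := by
  rw [tendsto_pi_nhds]
  intro i
  exact squeeze_zero (fun ℓ => (coupledRecursion_mem_Icc hf hg hfm hgm ℓ i).1)
    (fun ℓ => (coupledRecursion_mem_Icc hf hg hfm hgm ℓ i).2)
    (tendsto_halfLineRecursion_zero hw hf hg hfm hgm hfc hgc hU i)

/-! ### Polynomials with non-negative coefficients -/

namespace Polynomial

variable {p : ℝ[X]}

lemma coeff_derivative_nonneg (hp : ∀ i, 0 ≤ p.coeff i) (i : ℕ) : 0 ≤ p.derivative.coeff i := by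
  rw [coeff_derivative]
  exact mul_nonneg (hp _) (by positivity)

lemma eval_derivative_eq_sum_range (p : ℝ[X]) (x : ℝ) :
    p.derivative.eval x =
      ∑ i ∈ Finset.range (p.natDegree + 1), p.coeff i * (i * x ^ (i - 1)) := by
  rw [derivative_eval, sum_over_range]
  · simp only [mul_assoc]
  · simp

lemma eval_nonneg_of_coeff_nonneg (hp : ∀ i, 0 ≤ p.coeff i) {x : ℝ} (hx : 0 ≤ x) :
    0 ≤ p.eval x := by
  rw [eval_eq_sum_range]
  exact Finset.sum_nonneg fun i _ => mul_nonneg (hp i) (pow_nonneg hx i)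

lemma eval_le_eval_of_coeff_nonneg (hp : ∀ i, 0 ≤ p.coeff i) {x y : ℝ} (hx : 0 ≤ x)
    (hxy : x ≤ y) : p.eval x ≤ p.eval y := by
  rw [eval_eq_sum_range, eval_eq_sum_range]
  exact Finset.sum_le_sum fun i _ => mul_le_mul_of_nonneg_left (pow_le_pow_left₀ hx hxy i) (hp i)

lemma eval_pos_of_coeff_nonneg (hp : ∀ i, 0 ≤ p.coeff i) (h1 : 0 < p.eval 1) {x : ℝ}
    (hx : 0 < x) : 0 < p.eval x := by
  rw [eval_eq_sum_range] at h1 ⊢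
  obtain ⟨i, hi, hpos⟩ := Finset.exists_lt_of_sum_lt (s := Finset.range (p.natDegree + 1))
    (f := fun _ => (0 : ℝ)) (by simpa using h1)
  refine Finset.sum_pos' (fun i _ => mul_nonneg (hp i) (pow_nonneg hx.le i)) ⟨i, hi, ?_⟩
  exact mul_pos (by simpa using hpos) (pow_pos hx i)

lemma eval_le_chord (hp : ∀ i, 0 ≤ p.coeff i) {x : ℝ} (hx : x ∈ Icc (0 : ℝ) 1) :
    p.eval x ≤ p.eval 0 + x * (p.eval 1 - p.eval 0) := by
  simp only [eval_eq_sum_range]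
  rw [← Finset.sum_sub_distrib, Finset.mul_sum, ← Finset.sum_add_distrib]
  refine Finset.sum_le_sum fun i _ => ?_
  cases i with
  | zero => simp
  | succ i =>
    have h : x ^ (i + 1) ≤ x := pow_le_of_le_one hx.1 hx.2 (Nat.succ_ne_zero i)
    simpa [mul_comm] using mul_le_mul_of_nonneg_left h (hp (i + 1))

lemma eval_one_sub_eval_le (hp : ∀ i, 0 ≤ p.coeff i) {x : ℝ} (hx : x ∈ Icc (0 : ℝ) 1) :
    p.eval 1 - p.eval x ≤ p.derivative.eval 1 * (1 - x) := by
  rw [eval_derivative_eq_sum_range, eval_eq_sum_range, eval_eq_sum_range,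
    ← Finset.sum_sub_distrib, Finset.sum_mul]
  refine Finset.sum_le_sum fun i _ => ?_
  have h := one_add_mul_le_pow (a := x - 1) (by linarith [hx.1]) i
  rw [add_sub_cancel] at h
  rw [← mul_sub, mul_assoc]
  refine mul_le_mul_of_nonneg_left ?_ (hp i)
  simp only [one_pow, mul_one]
  linarith

/-- Termwise i ≤ deg p. It gives bounds relative to p itself, which survive as x tends to 0. -/
lemma mul_eval_derivative_le (hp : ∀ i, 0 ≤ p.coeff i) {x : ℝ} (hx : 0 ≤ x) :
    x * p.derivative.eval x ≤ p.natDegree * p.eval x := by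
  rw [eval_derivative_eq_sum_range, eval_eq_sum_range, Finset.mul_sum, Finset.mul_sum]
  refine Finset.sum_le_sum fun i hi => ?_
  cases i with
  | zero => simpa using mul_nonneg (Nat.cast_nonneg _) (hp 0)
  | succ i =>
    have h : ((i + 1 : ℕ) : ℝ) ≤ p.natDegree := by
      exact_mod_cast Nat.lt_succ_iff.1 (Finset.mem_range.1 hi)
    have h2 := mul_le_mul_of_nonneg_right h (mul_nonneg (hp (i + 1)) (pow_nonneg hx (i + 1)))
    rw [Nat.add_sub_cancel]
    refine le_trans (le_of_eq ?_) h2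
    ring

lemma eval_sub_eval_zero_le (hp : ∀ i, 0 ≤ p.coeff i) {x : ℝ} (hx : 0 ≤ x) :
    p.eval x - p.eval 0 ≤ x * p.derivative.eval x := by
  rw [eval_derivative_eq_sum_range, eval_eq_sum_range, eval_eq_sum_range,
    ← Finset.sum_sub_distrib, Finset.mul_sum]
  refine Finset.sum_le_sum fun i _ => ?_
  cases i with
  | zero => simp
  | succ i =>
    have h : (1 : ℝ) ≤ ((i + 1 : ℕ) : ℝ) := by exact_mod_cast Nat.succ_le_succ (Nat.zero_le i)
    have h2 := mul_le_mul_of_nonneg_right h (mul_nonneg (hp (i + 1)) (pow_nonneg hx (i + 1)))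
    rw [Nat.add_sub_cancel]
    simp only [ne_eq, Nat.succ_ne_zero, not_false_eq_true, zero_pow, mul_zero, sub_zero]
    refine le_trans (le_of_eq ?_) (h2.trans (le_of_eq ?_)) <;> ring

end Polynomial

namespace LDPCEnsemble

variable (E : LDPCEnsemble)

/-! ### Degree distributions -/

/-- The average variable-node degree `L'(1)`. -/
noncomputable def varDegree : ℝ := E.L.derivative.eval 1

/-- The average check-node degree `R'(1)`. -/
noncomputable def checkDegree : ℝ := E.R.derivative.eval 1

lemma L_eval_zero : E.L.eval 0 = 0 := by rw [← coeff_zero_eq_eval_zero, E.L_coeff_zero]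

lemma R_eval_zero : E.R.eval 0 = 0 := by rw [← coeff_zero_eq_eval_zero, E.R_coeff_zero]

lemma one_le_varDegree : 1 ≤ E.varDegree := by
  simpa [varDegree, E.L_sum, E.L_eval_zero] using eval_one_sub_eval_le E.L_nonneg (x := 0) (by simp)

lemma one_le_checkDegree : 1 ≤ E.checkDegree := by
  simpa [checkDegree, E.R_sum, E.R_eval_zero] using eval_one_sub_eval_le E.R_nonneg (x := 0) (by simp)

lemma varDegree_pos : 0 < E.varDegree := one_pos.trans_le E.one_le_varDegree

lemma checkDegree_pos : 0 < E.checkDegree := one_pos.trans_le E.one_le_checkDegree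

lemma varDegree_lt_checkDegree {E : LDPCEnsemble} (hr : 0 < E.designRate) :
    E.varDegree < E.checkDegree := by
  have h : E.varDegree / E.checkDegree < 1 := sub_pos.1 hr
  rwa [div_lt_one E.checkDegree_pos] at h

lemma lam_eval (x : ℝ) : E.lam.eval x = E.L.derivative.eval x / E.varDegree := by
  rw [lam, eval_mul, eval_C, varDegree, inv_mul_eq_div]

lemma rho_eval (x : ℝ) : E.rho.eval x = E.R.derivative.eval x / E.checkDegree := by
  rw [rho, eval_mul, eval_C, checkDegree, inv_mul_eq_div]

lemma lam_coeff_nonneg (i : ℕ) : 0 ≤ E.lam.coeff i := by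
  rw [lam, coeff_C_mul]
  exact mul_nonneg (inv_nonneg.2 E.varDegree_pos.le) (coeff_derivative_nonneg E.L_nonneg i)

lemma rho_coeff_nonneg (i : ℕ) : 0 ≤ E.rho.coeff i := by
  rw [rho, coeff_C_mul]
  exact mul_nonneg (inv_nonneg.2 E.checkDegree_pos.le) (coeff_derivative_nonneg E.R_nonneg i)

lemma lam_eval_one : E.lam.eval 1 = 1 := by
  rw [lam_eval]; exact div_self E.varDegree_pos.ne'

lemma rho_eval_one : E.rho.eval 1 = 1 := by
  rw [rho_eval]; exact div_self E.checkDegree_pos.ne'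

lemma lam_eval_zero : E.lam.eval 0 = 0 := by
  rw [lam_eval, ← coeff_zero_eq_eval_zero, coeff_derivative, E.L_coeff_one, zero_mul, zero_div]

lemma lam_eval_pos {y : ℝ} (hy : 0 < y) : 0 < E.lam.eval y :=
  eval_pos_of_coeff_nonneg E.lam_coeff_nonneg (by rw [lam_eval_one]; exact one_pos) hy

lemma L_eval_pos {y : ℝ} (hy : 0 < y) : 0 < E.L.eval y :=
  eval_pos_of_coeff_nonneg E.L_nonneg (by rw [E.L_sum]; exact one_pos) hy

lemma R_coeff_one_le : E.R.coeff 1 ≤ 1 := by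
  by_cases h : 1 ≤ E.R.natDegree
  · rw [← E.R_sum, eval_eq_sum_range]
    simpa using Finset.single_le_sum (f := fun i => E.R.coeff i * 1 ^ i)
      (fun i _ => by simpa using E.R_nonneg i) (Finset.mem_range.2 (Nat.lt_succ_of_le h))
  · rw [coeff_eq_zero_of_natDegree_lt (not_le.1 h)]
    exact zero_le_one

lemma rho_eval_zero_nonneg : 0 ≤ E.rho.eval 0 :=
  eval_nonneg_of_coeff_nonneg E.rho_coeff_nonneg le_rfl

/-- ρ(0) = R₁/R'(1), with R₁ ≤ 1 ≤ L'(1) < R'(1) by positivity of the rate. So ρ is not constant,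
and g is positive on (0,1]. -/
lemma rho_eval_zero_lt_one {E : LDPCEnsemble} (hr : 0 < E.designRate) : E.rho.eval 0 < 1 := by
  have h : E.R.derivative.eval 0 = E.R.coeff 1 := by
    rw [← coeff_zero_eq_eval_zero, coeff_derivative]; simp
  rw [rho_eval, h, div_lt_one E.checkDegree_pos]
  linarith [E.R_coeff_one_le, E.one_le_varDegree, varDegree_lt_checkDegree hr]

lemma rho_derivative_eval_pos {E : LDPCEnsemble} (hr : 0 < E.designRate) {y : ℝ} (hy : 0 < y) :
    0 < E.rho.derivative.eval y := by
  refine eval_pos_of_coeff_nonneg (coeff_derivative_nonneg E.rho_coeff_nonneg) ?_ hy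
  have h := eval_one_sub_eval_le E.rho_coeff_nonneg (x := 0) (by simp)
  rw [rho_eval_one] at h
  linarith [rho_eval_zero_lt_one hr]

/-! ### The check-node map and the antiderivatives -/

/-- The check-node map `g(x) = 1 - ρ(1 - x)`. -/
noncomputable def checkMap (x : ℝ) : ℝ := 1 - E.rho.eval (1 - x)

/-- The antiderivative of `λ`. -/
noncomputable def varEnergy (y : ℝ) : ℝ := E.L.eval y / E.varDegree

/-- `x g(x) - ∫_0^x g`. -/
noncomputable def checkEnergy (x : ℝ) : ℝ :=
  (1 - E.R.eval (1 - x)) / E.checkDegree - x * E.rho.eval (1 - x)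

lemma hasDerivAt_eval_one_sub (p : ℝ[X]) (x : ℝ) :
    HasDerivAt (fun y => p.eval (1 - y)) (-p.derivative.eval (1 - x)) x := by
  simpa using (p.hasDerivAt (1 - x)).comp_const_sub 1 x

lemma hasDerivAt_checkMap (x : ℝ) :
    HasDerivAt E.checkMap (E.rho.derivative.eval (1 - x)) x := by
  rw [← neg_neg (E.rho.derivative.eval (1 - x))]
  exact (hasDerivAt_eval_one_sub E.rho x).const_sub 1

lemma hasDerivAt_varEnergy (y : ℝ) : HasDerivAt E.varEnergy (E.lam.eval y) y := by
  rw [lam_eval]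
  exact (E.L.hasDerivAt y).div_const _

lemma hasDerivAt_checkEnergy (x : ℝ) :
    HasDerivAt E.checkEnergy (x * E.rho.derivative.eval (1 - x)) x := by
  have h := (((hasDerivAt_eval_one_sub E.R x).const_sub 1).div_const E.checkDegree).sub
    ((hasDerivAt_id x).mul (hasDerivAt_eval_one_sub E.rho x))
  refine h.congr_deriv ?_
  simp only [rho_eval, id]
  ring

lemma continuous_checkMap : Continuous E.checkMap :=
  continuous_iff_continuousAt.2 fun x => (E.hasDerivAt_checkMap x).continuousAt

lemma continuous_varEnergy : Continuous E.varEnergy :=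
  continuous_iff_continuousAt.2 fun x => (E.hasDerivAt_varEnergy x).continuousAt

lemma continuous_checkEnergy : Continuous E.checkEnergy :=
  continuous_iff_continuousAt.2 fun x => (E.hasDerivAt_checkEnergy x).continuousAt

lemma checkMap_zero : E.checkMap 0 = 0 := by simp [checkMap, rho_eval_one]

lemma varEnergy_zero : E.varEnergy 0 = 0 := by simp [varEnergy, L_eval_zero]

lemma checkEnergy_zero : E.checkEnergy 0 = 0 := by simp [checkEnergy, E.R_sum]

lemma monotoneOn_checkMap : MonotoneOn E.checkMap (Icc 0 1) := fun x _ y hy hxy =>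
  sub_le_sub_left (eval_le_eval_of_coeff_nonneg E.rho_coeff_nonneg (by linarith [hy.2])
    (by linarith)) 1

lemma mapsTo_checkMap : MapsTo E.checkMap (Icc 0 1) (Icc 0 1) := fun x hx => by
  refine ⟨?_, ?_⟩
  · simpa [checkMap_zero] using E.monotoneOn_checkMap (by simp) hx hx.1
  · exact sub_le_self _ (eval_nonneg_of_coeff_nonneg E.rho_coeff_nonneg (by linarith [hx.2]))

lemma checkMap_pos {E : LDPCEnsemble} (hr : 0 < E.designRate) {x : ℝ} (hx : x ∈ Ioc (0 : ℝ) 1) :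
    0 < E.checkMap x := by
  have h := eval_le_chord E.rho_coeff_nonneg (x := 1 - x) ⟨by linarith [hx.2], by linarith [hx.1]⟩
  rw [rho_eval_one] at h
  have := mul_pos hx.1 (sub_pos.2 (rho_eval_zero_lt_one hr))
  rw [checkMap]
  linarith

lemma lam_checkMap_pos {E : LDPCEnsemble} (hr : 0 < E.designRate) {x : ℝ}
    (hx : x ∈ Ioc (0 : ℝ) 1) : 0 < E.lam.eval (E.checkMap x) :=
  E.lam_eval_pos (checkMap_pos hr hx)

lemma varEnergy_pos {E : LDPCEnsemble} (hr : 0 < E.designRate) {x : ℝ}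
    (hx : x ∈ Ioc (0 : ℝ) 1) : 0 < E.varEnergy (E.checkMap x) :=
  div_pos (E.L_eval_pos (checkMap_pos hr hx)) E.varDegree_pos

lemma checkEnergy_pos {E : LDPCEnsemble} (hr : 0 < E.designRate) {x : ℝ}
    (hx : x ∈ Ioc (0 : ℝ) 1) : 0 < E.checkEnergy x := by
  have h : StrictMonoOn E.checkEnergy (Icc 0 1) := by
    refine strictMonoOn_of_deriv_pos (convex_Icc 0 1) E.continuous_checkEnergy.continuousOn ?_
    intro y hy
    rw [interior_Icc] at hy
    rw [(E.hasDerivAt_checkEnergy y).deriv]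
    exact mul_pos hy.1 (rho_derivative_eval_pos hr (by linarith [hy.2]))
  simpa [checkEnergy_zero] using h (by simp) (Ioc_subset_Icc_self hx) hx.1

lemma integral_checkMap (x : ℝ) :
    x * E.checkMap x - ∫ z in (0 : ℝ)..x, E.checkMap z = E.checkEnergy x := by
  rw [intervalIntegral.integral_eq_sub_of_hasDerivAt
    (f := fun z => z + E.R.eval (1 - z) / E.checkDegree)
    (fun z _ => ?_) (E.continuous_checkMap.intervalIntegrable _ _)]
  · simp only [checkMap, checkEnergy, sub_zero, E.R_sum]
    ring
  · refine ((hasDerivAt_id z).add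
      ((hasDerivAt_eval_one_sub E.R z).div_const E.checkDegree)).congr_deriv ?_
    rw [checkMap, rho_eval]
    ring

lemma integral_lam (ε y : ℝ) :
    ∫ z in (0 : ℝ)..y, ε * E.lam.eval z = ε * E.varEnergy y := by
  rw [intervalIntegral.integral_const_mul, intervalIntegral.integral_eq_sub_of_hasDerivAt
    (f := E.varEnergy) (fun z _ => E.hasDerivAt_varEnergy z)
    (E.lam.continuous.intervalIntegrable _ _), varEnergy_zero, sub_zero]

lemma scalarPotential_eq (x ε : ℝ) :
    scalarPotential E.f E.g x ε = E.checkEnergy x - ε * E.varEnergy (E.checkMap x) := by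
  rw [← integral_checkMap, ← integral_lam]
  rfl

/-- This is U(1;1) < 0. Here C(1) = 1/R'(1) - ρ(0), while the tangent of L at 1 gives V(g(1)) ≥
1/L'(1) - ρ(0); positive rate compares the two. -/
lemma checkEnergy_one_lt {E : LDPCEnsemble} (hr : 0 < E.designRate) :
    E.checkEnergy 1 < E.varEnergy (E.checkMap 1) := by
  have h0 := E.rho_eval_zero_nonneg
  have h := eval_one_sub_eval_le E.L_nonneg (x := E.checkMap 1) (E.mapsTo_checkMap (by simp))
  have h2 : 1 / E.checkDegree < 1 / E.varDegree :=
    one_div_lt_one_div_of_lt E.varDegree_pos (varDegree_lt_checkDegree hr)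
  have h3 : 1 / E.varDegree - E.rho.eval 0 ≤ E.varEnergy (E.checkMap 1) := by
    rw [varEnergy, le_div_iff₀ E.varDegree_pos, sub_mul, one_div, inv_mul_cancel₀
      E.varDegree_pos.ne']
    rw [E.L_sum] at h
    simp only [checkMap, sub_self, sub_sub_cancel] at h ⊢
    rw [varDegree]
    linarith
  simp only [checkEnergy, sub_self, E.R_eval_zero, sub_zero, one_mul]
  linarith

/-! ### The trial entropy -/

lemma fixedPointParameter_eq (x : ℝ) :
    E.fixedPointParameter x = x / E.lam.eval (E.checkMap x) := rfl

lemma hasDerivAt_lam_checkMap (x : ℝ) : HasDerivAt (fun z => E.lam.eval (E.checkMap z))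
    (E.lam.derivative.eval (E.checkMap x) * E.rho.derivative.eval (1 - x)) x :=
  (E.lam.hasDerivAt (E.checkMap x)).comp x (E.hasDerivAt_checkMap x)

lemma hasDerivAt_fixedPointParameter {E : LDPCEnsemble} (hr : 0 < E.designRate) {x : ℝ}
    (hx : x ∈ Ioc (0 : ℝ) 1) : HasDerivAt E.fixedPointParameter
      ((E.lam.eval (E.checkMap x) - x * (E.lam.derivative.eval (E.checkMap x) *
        E.rho.derivative.eval (1 - x))) / E.lam.eval (E.checkMap x) ^ 2) x := by
  refine ((hasDerivAt_id x).div (E.hasDerivAt_lam_checkMap x)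
    (lam_checkMap_pos hr hx).ne').congr_deriv ?_
  rw [one_mul, id]

lemma varEnergy_le {y : ℝ} (hy : 0 ≤ y) : E.varEnergy y ≤ y * E.lam.eval y := by
  have h := eval_sub_eval_zero_le E.L_nonneg hy
  rw [L_eval_zero, sub_zero] at h
  rw [varEnergy, lam_eval, ← mul_div_assoc]
  exact div_le_div_of_nonneg_right h E.varDegree_pos.le

/-- Although ε' may blow up at 0, V compensates: with y = g(x), V/λ ≤ y and y λ'/λ ≤ deg λ. The
bound yields integrability up to 0. -/
lemma abs_trialEntropy_integrand_le {E : LDPCEnsemble} (hr : 0 < E.designRate) {x : ℝ}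
    (hx : x ∈ Ioc (0 : ℝ) 1) :
    |E.varEnergy (E.checkMap x) * deriv E.fixedPointParameter x| ≤
      1 + E.lam.natDegree * E.rho.derivative.eval 1 := by
  rw [(hasDerivAt_fixedPointParameter hr hx).deriv]
  have hg := E.mapsTo_checkMap (Ioc_subset_Icc_self hx)
  have hl := lam_checkMap_pos hr hx
  have hV := varEnergy_pos hr hx
  have hV' := E.varEnergy_le hg.1
  have hd := mul_eval_derivative_le E.lam_coeff_nonneg hg.1
  have hd0 : 0 ≤ E.lam.derivative.eval (E.checkMap x) :=
    eval_nonneg_of_coeff_nonneg (coeff_derivative_nonneg E.lam_coeff_nonneg) hg.1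
  have hr0 : 0 ≤ E.rho.derivative.eval (1 - x) :=
    eval_nonneg_of_coeff_nonneg (coeff_derivative_nonneg E.rho_coeff_nonneg) (by linarith [hx.2])
  have hr1 : E.rho.derivative.eval (1 - x) ≤ E.rho.derivative.eval 1 :=
    eval_le_eval_of_coeff_nonneg (coeff_derivative_nonneg E.rho_coeff_nonneg) (by linarith [hx.2])
      (by linarith [hx.1])
  set y := E.checkMap x
  set l := E.lam.eval y
  set m := E.lam.derivative.eval y
  set V := E.varEnergy y
  set q := E.rho.derivative.eval (1 - x)
  have hxq : x * q ≤ E.rho.derivative.eval 1 := by nlinarith [hx.1, hx.2]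
  have hxq0 : 0 ≤ x * q := mul_nonneg hx.1.le hr0
  have e : V * ((l - x * (m * q)) / l ^ 2) = V / l - (V / l) * (m / l) * (x * q) := by
    field_simp
  have h1 : V / l ≤ y := by rwa [div_le_iff₀ hl]
  have h2 : y * (m / l) ≤ E.lam.natDegree := by rwa [← mul_div_assoc, div_le_iff₀ hl]
  have h0 : 0 ≤ V / l := (div_pos hV hl).le
  have h0' : 0 ≤ m / l := div_nonneg hd0 hl.le
  have h3 : (V / l) * (m / l) ≤ E.lam.natDegree :=
    (mul_le_mul_of_nonneg_right h1 h0').trans h2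
  have h4 : (V / l) * (m / l) * (x * q) ≤ E.lam.natDegree * E.rho.derivative.eval 1 :=
    mul_le_mul h3 hxq hxq0 (Nat.cast_nonneg _)
  have h5 : 0 ≤ (V / l) * (m / l) * (x * q) := mul_nonneg (mul_nonneg h0 h0') hxq0
  have h6 : y ≤ 1 := hg.2
  rw [e, abs_le]
  constructor <;> linarith

lemma intervalIntegrable_trialEntropy_integrand {E : LDPCEnsemble} (hr : 0 < E.designRate) {x : ℝ}
    (hx : x ∈ Icc (0 : ℝ) 1) :
    IntervalIntegrable (fun z => E.varEnergy (E.checkMap z) * deriv E.fixedPointParameter z)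
      MeasureTheory.volume 0 x := by
  rw [intervalIntegrable_iff_integrableOn_Ioc_of_le hx.1]
  refine MeasureTheory.IntegrableOn.of_bound (by simp)
    (((E.continuous_varEnergy.comp E.continuous_checkMap).measurable.mul
      (measurable_deriv _)).aestronglyMeasurable) (1 + E.lam.natDegree * E.rho.derivative.eval 1) ?_
  filter_upwards [MeasureTheory.ae_restrict_mem measurableSet_Ioc] with z hz
  exact abs_trialEntropy_integrand_le hr ⟨hz.1, hz.2.trans hx.2⟩

/-- Up to the factor `-L'(1)`, the trial entropy is the potential along `ε(x)`. -/
lemma trialEntropy_eq {E : LDPCEnsemble} (hr : 0 < E.designRate) {x : ℝ}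
    (hx : x ∈ Icc (0 : ℝ) 1) : E.trialEntropy x = E.varDegree *
      (E.varEnergy (E.checkMap x) * E.fixedPointParameter x - E.checkEnergy x) := by
  have hint : E.trialEntropy x = E.varDegree * ∫ z in (0 : ℝ)..x,
      E.varEnergy (E.checkMap z) * deriv E.fixedPointParameter z := by
    rw [← intervalIntegral.integral_const_mul, trialEntropy]
    congr 1
    funext z
    rw [← mul_assoc, varEnergy, mul_div_cancel₀ _ E.varDegree_pos.ne', checkMap]
  rw [hint]
  congr 1
  -- Since λ(g(z)) ε(z) = z, the term (V ∘ g)' ε cancels C', leaving (V ∘ g) ε'.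
  have hder (z : ℝ) (hz : z ∈ Ioc (0 : ℝ) 1) : HasDerivAt
      (fun z => E.varEnergy (E.checkMap z) * E.fixedPointParameter z - E.checkEnergy z)
      (E.varEnergy (E.checkMap z) * deriv E.fixedPointParameter z) z := by
    have h := (((E.hasDerivAt_varEnergy _).comp z (E.hasDerivAt_checkMap z)).mul
      (hasDerivAt_fixedPointParameter hr hz)).sub (E.hasDerivAt_checkEnergy z)
    refine h.congr_deriv ?_
    rw [(hasDerivAt_fixedPointParameter hr hz).deriv]
    have := (lam_checkMap_pos hr hz).ne'
    simp only [Function.comp_apply, fixedPointParameter_eq]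
    field_simp
    ring
  -- ε(z) may tend to infinity at 0, so continuity of the product comes from V(g(z)) ε(z) ≤ z g(z).
  -- The conventional value of ε at 0 does not matter, as it is multiplied by V(0) = 0.
  have h0 : ContinuousWithinAt
      (fun z => E.varEnergy (E.checkMap z) * E.fixedPointParameter z - E.checkEnergy z)
      (Icc 0 x) 0 := by
    refine ContinuousWithinAt.sub ?_ E.continuous_checkEnergy.continuousWithinAt
    have hz0 : E.varEnergy (E.checkMap 0) * E.fixedPointParameter 0 = 0 := by
      simp [checkMap_zero, varEnergy_zero]
    rw [ContinuousWithinAt, hz0]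
    refine squeeze_zero' (g := fun z => E.checkMap z * z) ?_ ?_ ?_
    · filter_upwards [self_mem_nhdsWithin] with z hz
      have hg := (E.mapsTo_checkMap ⟨hz.1, hz.2.trans hx.2⟩).1
      exact mul_nonneg (div_nonneg (eval_nonneg_of_coeff_nonneg E.L_nonneg hg) E.varDegree_pos.le)
        (div_nonneg hz.1 (eval_nonneg_of_coeff_nonneg E.lam_coeff_nonneg hg))
    · filter_upwards [self_mem_nhdsWithin] with z hz
      rcases hz.1.eq_or_lt with rfl | hz0
      · simp [checkMap_zero, varEnergy_zero]
      · have hz1 : z ∈ Ioc (0 : ℝ) 1 := ⟨hz0, hz.2.trans hx.2⟩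
        have hl := lam_checkMap_pos hr hz1
        rw [fixedPointParameter_eq, ← mul_div_assoc, div_le_iff₀ hl]
        have := mul_le_mul_of_nonneg_right (E.varEnergy_le (checkMap_pos hr hz1).le) hz0.le
        linarith
    · have : Tendsto (fun z => E.checkMap z * z) (𝓝 0) (𝓝 (E.checkMap 0 * 0)) :=
        (E.continuous_checkMap.mul continuous_id).tendsto 0
      rw [mul_zero] at this
      exact this.mono_left nhdsWithin_le_nhds
  rw [intervalIntegral.integral_eq_sub_of_hasDerivAt_of_le hx.1 (f := fun z =>
    E.varEnergy (E.checkMap z) * E.fixedPointParameter z - E.checkEnergy z) ?_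
    (fun z hz => hder z ⟨hz.1, hz.2.le.trans hx.2⟩)
    (intervalIntegrable_trialEntropy_integrand hr hx)]
  · simp [checkMap_zero, varEnergy_zero, checkEnergy_zero]
  · intro z hz
    rcases hz.1.eq_or_lt with rfl | hz0
    · exact h0
    · exact (hder z ⟨hz0, hz.2.trans hx.2⟩).continuousAt.continuousWithinAt

lemma trialEntropy_eq_zero_iff {E : LDPCEnsemble} (hr : 0 < E.designRate) {x : ℝ}
    (hx : x ∈ Ioc (0 : ℝ) 1) : E.trialEntropy x = 0 ↔
      x * E.varEnergy (E.checkMap x) = E.lam.eval (E.checkMap x) * E.checkEnergy x := by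
  rw [trialEntropy_eq hr (Ioc_subset_Icc_self hx), mul_eq_zero, or_iff_right E.varDegree_pos.ne',
    sub_eq_zero, fixedPointParameter_eq, ← mul_div_assoc,
    div_eq_iff (lam_checkMap_pos hr hx).ne', mul_comm x, mul_comm (E.lam.eval _)]

/-! ### The energy ratio -/

/-- The ratio of the variable to the check energy, extended continuously to `0`. Its reciprocal is
the parameter at which the potential vanishes at `x`. -/
noncomputable def energyRatio (x : ℝ) : ℝ :=
  if x = 0 then E.lam.derivative.eval 0 * E.rho.derivative.eval 1
  else E.varEnergy (E.checkMap x) / E.checkEnergy x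

lemma energyRatio_of_pos {x : ℝ} (hx : 0 < x) :
    E.energyRatio x = E.varEnergy (E.checkMap x) / E.checkEnergy x := if_neg hx.ne'

/-- By l'Hôpital: the factor ρ'(1 - x) cancels from the derivatives, leaving λ(g(x))/x, a difference
quotient of λ ∘ g at 0. -/
lemma tendsto_energyRatio_zero {E : LDPCEnsemble} (hr : 0 < E.designRate) :
    Tendsto (fun x => E.varEnergy (E.checkMap x) / E.checkEnergy x) (𝓝[>] 0)
      (𝓝 (E.lam.derivative.eval 0 * E.rho.derivative.eval 1)) := by
  have hI : Ioo (0 : ℝ) 1 ∈ 𝓝[>] (0 : ℝ) := Ioo_mem_nhdsGT one_pos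
  refine HasDerivAt.lhopital_zero_nhdsGT
    (f' := fun x => E.lam.eval (E.checkMap x) * E.rho.derivative.eval (1 - x))
    (g' := fun x => x * E.rho.derivative.eval (1 - x))
    (Eventually.of_forall fun x =>
      (E.hasDerivAt_varEnergy _).comp x (E.hasDerivAt_checkMap x))
    (Eventually.of_forall fun x => E.hasDerivAt_checkEnergy x) ?_ ?_ ?_ ?_
  · filter_upwards [hI] with x hx
    exact (mul_pos hx.1 (rho_derivative_eval_pos hr (by linarith [hx.2]))).ne'
  · have h := (E.continuous_varEnergy.comp E.continuous_checkMap).tendsto 0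
    simp only [Function.comp_apply, checkMap_zero, varEnergy_zero] at h
    exact h.mono_left nhdsWithin_le_nhds
  · have h := E.continuous_checkEnergy.tendsto 0
    rw [checkEnergy_zero] at h
    exact h.mono_left nhdsWithin_le_nhds
  · have h := (E.hasDerivAt_lam_checkMap 0).tendsto_slope
    rw [checkMap_zero, sub_zero] at h
    refine (h.mono_left (nhdsWithin_mono _ fun x hx => (ne_of_gt hx))).congr' ?_
    filter_upwards [hI] with x hx
    have := (rho_derivative_eval_pos hr (show 0 < 1 - x by linarith [hx.2])).ne'
    rw [slope_def_field, checkMap_zero, lam_eval_zero, sub_zero, sub_zero,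
      mul_div_mul_right _ _ this]

lemma continuousOn_energyRatio {E : LDPCEnsemble} (hr : 0 < E.designRate) :
    ContinuousOn E.energyRatio (Icc 0 1) := by
  intro x hx
  rcases hx.1.eq_or_lt with rfl | hx0
  · have h : ContinuousWithinAt E.energyRatio (Ioi 0) 0 := by
      rw [ContinuousWithinAt, energyRatio, if_pos rfl]
      refine (tendsto_energyRatio_zero hr).congr' ?_
      filter_upwards [self_mem_nhdsWithin] with x hx
      exact (E.energyRatio_of_pos hx).symm
    exact (continuousWithinAt_Ioi_iff_Ici.1 h).mono Icc_subset_Ici_self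
  · refine ContinuousAt.continuousWithinAt ?_
    have h : ContinuousAt (fun z => E.varEnergy (E.checkMap z) / E.checkEnergy z) x :=
      (E.continuous_varEnergy.comp E.continuous_checkMap).continuousAt.div
        E.continuous_checkEnergy.continuousAt (checkEnergy_pos hr ⟨hx0, hx.2⟩).ne'
    refine h.congr ?_
    filter_upwards [Ioi_mem_nhds hx0] with z hz
    exact (E.energyRatio_of_pos hz).symm

lemma hasDerivAt_energyRatio {E : LDPCEnsemble} (hr : 0 < E.designRate) {x : ℝ}
    (hx : x ∈ Ioc (0 : ℝ) 1) : HasDerivAt E.energyRatio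
      (E.rho.derivative.eval (1 - x) * (E.lam.eval (E.checkMap x) * E.checkEnergy x -
        x * E.varEnergy (E.checkMap x)) / E.checkEnergy x ^ 2) x := by
  have h := ((E.hasDerivAt_varEnergy _).comp x (E.hasDerivAt_checkMap x)).div
    (E.hasDerivAt_checkEnergy x) (checkEnergy_pos hr hx).ne'
  refine (h.congr_of_eventuallyEq ?_).congr_deriv ?_
  · filter_upwards [Ioi_mem_nhds hx.1] with z hz
    exact E.energyRatio_of_pos hz
  · simp only [Function.comp_apply]
    ring

lemma trialEntropy_eq_zero_of_isMaxOn {E : LDPCEnsemble} (hr : 0 < E.designRate) {x : ℝ}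
    (hx : x ∈ Ioo (0 : ℝ) 1) (hmax : IsMaxOn E.energyRatio (Icc 0 1) x) :
    E.trialEntropy x = 0 := by
  have hx' : x ∈ Ioc (0 : ℝ) 1 := ⟨hx.1, hx.2.le⟩
  have h := (hmax.isLocalMax (Icc_mem_nhds hx.1 hx.2)).hasDerivAt_eq_zero
    (hasDerivAt_energyRatio hr hx')
  rw [div_eq_zero_iff, or_iff_left (pow_ne_zero 2 (checkEnergy_pos hr hx').ne'), mul_eq_zero,
    or_iff_right (rho_derivative_eval_pos hr (by linarith [hx.2])).ne', sub_eq_zero] at h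
  exact (trialEntropy_eq_zero_iff hr hx').2 h.symm

lemma one_lt_energyRatio_one {E : LDPCEnsemble} (hr : 0 < E.designRate) :
    1 < E.energyRatio 1 := by
  rw [E.energyRatio_of_pos one_pos, one_lt_div (checkEnergy_pos hr (by simp))]
  exact checkEnergy_one_lt hr

/-- Q' may vanish at 1 through its factor ρ'(0), so the sign of the other factor D is used on a
neighbourhood. D(1) < 0 because λ ≤ 1 and C(1) < V(g(1)), hence Q is antitone near 1. If 1 were a
maximizer, so would be a nearby interior b, forcing D(b) = 0. -/
lemma not_isMaxOn_energyRatio_one {E : LDPCEnsemble} (hr : 0 < E.designRate) :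
    ¬ IsMaxOn E.energyRatio (Icc 0 1) 1 := by
  intro hmax
  set D : ℝ → ℝ := fun x => E.lam.eval (E.checkMap x) * E.checkEnergy x -
    x * E.varEnergy (E.checkMap x) with hD
  have hDc : Continuous D :=
    ((E.lam.continuous.comp E.continuous_checkMap).mul E.continuous_checkEnergy).sub
      (continuous_id.mul (E.continuous_varEnergy.comp E.continuous_checkMap))
  have hD1 : D 1 < 0 := by
    have hg := E.mapsTo_checkMap (x := 1) (by simp)
    have h1 := eval_le_eval_of_coeff_nonneg E.lam_coeff_nonneg hg.1 hg.2
    rw [lam_eval_one] at h1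
    have h2 := mul_le_mul_of_nonneg_right h1 (checkEnergy_pos hr (x := 1) (by simp)).le
    have h3 := checkEnergy_one_lt hr
    simp only [hD]
    linarith
  obtain ⟨a, ha1, ha⟩ : ∃ a < (1 : ℝ), Ioc a 1 ⊆ {x | D x < 0} :=
    exists_Ioc_subset_of_mem_nhds (hDc.continuousAt.eventually_lt continuousAt_const hD1)
      ⟨0, one_pos⟩
  obtain ⟨b, hb, hb1⟩ := exists_between (max_lt ha1 one_pos)
  have hb0 : 0 < b := (le_max_right _ _).trans_lt hb
  have hba : a < b := (le_max_left _ _).trans_lt hb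
  have hanti : AntitoneOn E.energyRatio (Icc b 1) := by
    refine antitoneOn_of_deriv_nonpos (convex_Icc b 1)
      ((continuousOn_energyRatio hr).mono (Icc_subset_Icc_left hb0.le)) ?_ ?_
    · intro z hz
      rw [interior_Icc] at hz
      exact (hasDerivAt_energyRatio hr
        ⟨hb0.trans hz.1, hz.2.le⟩).differentiableAt.differentiableWithinAt
    · intro z hz
      rw [interior_Icc] at hz
      rw [(hasDerivAt_energyRatio hr ⟨hb0.trans hz.1, hz.2.le⟩).deriv]
      have hDz : D z < 0 := ha ⟨hba.trans hz.1, hz.2.le⟩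
      exact div_nonpos_of_nonpos_of_nonneg (mul_nonpos_of_nonneg_of_nonpos
        (rho_derivative_eval_pos hr (by linarith [hz.2])).le hDz.le) (sq_nonneg _)
  have hle := hanti ⟨le_rfl, hb1.le⟩ ⟨hb1.le, le_rfl⟩ hb1.le
  have hbmax : IsMaxOn E.energyRatio (Icc 0 1) b := fun z hz => (hmax hz).trans hle
  have h0 := (trialEntropy_eq_zero_iff hr ⟨hb0, hb1.le⟩).1
    (trialEntropy_eq_zero_of_isMaxOn hr ⟨hb0, hb1⟩ hbmax)
  have hDb : D b < 0 := ha ⟨hba, hb1.le⟩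
  simp only [hD] at hDb
  linarith

/-- The energy ratio has a maximum `M > 1`, attained at `0` or at an interior zero of the trial
entropy. -/
lemma exists_isMaxOn_energyRatio {E : LDPCEnsemble} (hr : 0 < E.designRate) :
    ∃ x ∈ Ico (0 : ℝ) 1, IsMaxOn E.energyRatio (Icc 0 1) x ∧ 1 < E.energyRatio x := by
  obtain ⟨x, hx, hmax⟩ := isCompact_Icc.exists_isMaxOn (nonempty_Icc.2 zero_le_one)
    (continuousOn_energyRatio hr)
  refine ⟨x, ⟨hx.1, lt_of_le_of_ne hx.2 ?_⟩, hmax,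
    (one_lt_energyRatio_one hr).trans_le (hmax (by simp))⟩
  rintro rfl
  exact not_isMaxOn_energyRatio_one hr hmax

/-! ### The thresholds -/

/-- This links the two thresholds: at zeros of P, ε(x) is the parameter at which the potential
vanishes. Positivity of Q excludes the case ε(0) = ∞. -/
lemma extendedParameter_of_trialEntropy_eq_zero {E : LDPCEnsemble} (hr : 0 < E.designRate) {x : ℝ}
    (hx : x ∈ Icc (0 : ℝ) 1) (hP : E.trialEntropy x = 0) (hpos : 0 < E.energyRatio x) :
    E.extendedParameter x = ((1 / E.energyRatio x : ℝ) : EReal) := by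
  rcases hx.1.eq_or_lt with rfl | hx0
  · rw [energyRatio, if_pos rfl] at hpos ⊢
    rw [extendedParameter, if_pos rfl, stabilityValue, if_pos hpos]
  · have hx' : x ∈ Ioc (0 : ℝ) 1 := ⟨hx0, hx.2⟩
    have h := (trialEntropy_eq_zero_iff hr hx').1 hP
    rw [extendedParameter, if_neg hx0.ne', fixedPointParameter_eq, E.energyRatio_of_pos hx0,
      one_div_div]
    congr 1
    rw [div_eq_div_iff (lam_checkMap_pos hr hx').ne' (varEnergy_pos hr hx').ne', h, mul_comm]

lemma isLeast_maxwellCandidates {E : LDPCEnsemble} (hr : 0 < E.designRate) {x : ℝ}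
    (hx : x ∈ Ico (0 : ℝ) 1) (hmax : IsMaxOn E.energyRatio (Icc 0 1) x)
    (h1 : 1 < E.energyRatio x) :
    IsLeast E.maxwellCandidates ((1 / E.energyRatio x : ℝ) : EReal) := by
  have hpos : 0 < E.energyRatio x := one_pos.trans h1
  constructor
  · have hP : E.trialEntropy x = 0 := by
      rcases hx.1.eq_or_lt with rfl | hx0
      · exact intervalIntegral.integral_same
      · exact trialEntropy_eq_zero_of_isMaxOn hr ⟨hx0, hx.2⟩ hmax
    exact ⟨x, Ico_subset_Icc_self hx, hP, (extendedParameter_of_trialEntropy_eq_zero hr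
      (Ico_subset_Icc_self hx) hP hpos).symm⟩
  · rintro _ ⟨z, hz, hP, rfl⟩
    by_cases hz0 : 0 < E.energyRatio z
    · rw [extendedParameter_of_trialEntropy_eq_zero hr hz hP hz0]
      exact EReal.coe_le_coe_iff.2 (one_div_le_one_div_of_le hz0 (hmax hz))
    · rcases hz.1.eq_or_lt with rfl | hz1
      · rw [energyRatio, if_pos rfl] at hz0
        rw [extendedParameter, if_pos rfl, stabilityValue, if_neg hz0]
        exact le_top
      · refine absurd ?_ hz0
        rw [E.energyRatio_of_pos hz1]
        exact div_pos (varEnergy_pos hr ⟨hz1, hz.2⟩) (checkEnergy_pos hr ⟨hz1, hz.2⟩)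

/-- P(0) = 0 always holds, so the stability value is itself one of the candidates. -/
lemma maxwellThreshold_eq_sInf : E.maxwellThreshold = sInf E.maxwellCandidates := by
  have h : E.maxwellCandidates = insert E.stabilityValue {e : EReal | ∃ x ∈ Ioc (0 : ℝ) 1,
      E.trialEntropy x = 0 ∧ e = (E.fixedPointParameter x : EReal)} := by
    ext e
    constructor
    · rintro ⟨x, hx, hP, rfl⟩
      rcases hx.1.eq_or_lt with rfl | hx0
      · exact Or.inl (if_pos rfl)
      · exact Or.inr ⟨x, ⟨hx0, hx.2⟩, hP, if_neg hx0.ne'⟩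
    · rintro (rfl | ⟨x, hx, hP, rfl⟩)
      · exact ⟨0, by simp, intervalIntegral.integral_same, (if_pos rfl).symm⟩
      · exact ⟨x, Ioc_subset_Icc_self hx, hP, (if_neg hx.1.ne').symm⟩
  rw [h, sInf_insert]
  rfl

/-- Since U(0;ε) = 0, any x > 0 with U(x;ε) ≤ 0 would prevent 0 from being the largest minimizer. -/
lemma mem_zeroMinimizerParameters_iff {ε : ℝ} :
    ε ∈ zeroMinimizerParameters E.f E.g 1 1 ↔ ε ∈ Icc (0 : ℝ) 1 ∧
      ∀ x ∈ Ioc (0 : ℝ) 1, ε * E.varEnergy (E.checkMap x) < E.checkEnergy x := by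
  have h0 : scalarPotential E.f E.g 0 ε = 0 := by
    simp [scalarPotential_eq, checkMap_zero, varEnergy_zero, checkEnergy_zero]
  refine and_congr_right fun _ => ⟨fun h x hx => ?_, fun h => ⟨⟨by simp, fun z hz => ?_⟩, ?_⟩⟩
  · have hle := h.1.2 x (Ioc_subset_Icc_self hx)
    rw [← sub_pos, ← scalarPotential_eq]
    rw [h0] at hle
    refine lt_of_le_of_ne hle fun heq => hx.1.not_ge (h.2 ⟨Ioc_subset_Icc_self hx, fun z hz => ?_⟩)
    rw [← heq, ← h0]
    exact h.1.2 z hz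
  · rcases hz.1.eq_or_lt with rfl | hz0
    · exact le_rfl
    · rw [h0, scalarPotential_eq]
      exact (sub_pos.2 (h z ⟨hz0, hz.2⟩)).le
  · rintro z ⟨hz, hmin⟩
    by_contra hz0
    have hlt := sub_pos.2 (h z ⟨not_le.1 hz0, hz.2⟩)
    rw [← scalarPotential_eq] at hlt
    exact (hlt.trans_le (hmin 0 (by simp))).ne h0.symm

lemma zero_mem_zeroMinimizerParameters {E : LDPCEnsemble} (hr : 0 < E.designRate) :
    0 ∈ zeroMinimizerParameters E.f E.g 1 1 :=
  E.mem_zeroMinimizerParameters_iff.2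
    ⟨by simp, fun x hx => by simpa using checkEnergy_pos hr hx⟩

lemma isLUB_epsC {E : LDPCEnsemble} (hr : 0 < E.designRate) :
    IsLUB (zeroMinimizerParameters E.f E.g 1 1) E.epsC :=
  isLUB_csSup ⟨0, zero_mem_zeroMinimizerParameters hr⟩ ⟨1, fun _ h => h.1.2⟩

lemma lt_one_div_energyRatio_iff {E : LDPCEnsemble} (hr : 0 < E.designRate) {x ε : ℝ}
    (hx : x ∈ Ioc (0 : ℝ) 1) :
    ε * E.energyRatio x < 1 ↔ ε * E.varEnergy (E.checkMap x) < E.checkEnergy x := by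
  rw [E.energyRatio_of_pos hx.1, ← mul_div_assoc, div_lt_one (checkEnergy_pos hr hx)]

lemma isLUB_one_div_energyRatio {E : LDPCEnsemble} (hr : 0 < E.designRate) {x : ℝ}
    (hx : x ∈ Ico (0 : ℝ) 1) (hmax : IsMaxOn E.energyRatio (Icc 0 1) x)
    (h1 : 1 < E.energyRatio x) :
    IsLUB (zeroMinimizerParameters E.f E.g 1 1) (1 / E.energyRatio x) := by
  have hpos : 0 < E.energyRatio x := one_pos.trans h1
  constructor
  · intro ε hε
    rw [mem_zeroMinimizerParameters_iff] at hε
    rw [le_div_iff₀ hpos]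
    have hlt (z : ℝ) (hz : z ∈ Ioc (0 : ℝ) 1) : ε * E.energyRatio z ≤ 1 :=
      ((lt_one_div_energyRatio_iff hr hz).2 (hε.2 z hz)).le
    rcases hx.1.eq_or_lt with rfl | hx0
    · have hc := (continuousOn_energyRatio hr 0 (by simp)).mono Ioc_subset_Icc_self
      have := mem_closure_iff_nhdsWithin_neBot.1
        (show (0 : ℝ) ∈ closure (Ioc 0 1) by rw [closure_Ioc zero_ne_one]; simp)
      refine le_of_tendsto (hc.tendsto.const_mul ε) ?_
      filter_upwards [self_mem_nhdsWithin] with z hz using hlt z hz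
    · exact hlt x ⟨hx0, hx.2.le⟩
  · intro b hb
    -- Every ε in [0, 1/max Q) belongs to the set; ε ≤ 1 holds because max Q > 1. Negative ε are
    -- compared with the member 0.
    refine le_of_forall_lt_imp_le_of_dense fun ε hε => ?_
    rcases lt_or_ge ε 0 with h0 | h0
    · exact h0.le.trans (hb (zero_mem_zeroMinimizerParameters hr))
    · refine hb (E.mem_zeroMinimizerParameters_iff.2
        ⟨⟨h0, hε.le.trans ((div_le_one hpos).2 h1.le)⟩, fun z hz => ?_⟩)
      rw [← lt_one_div_energyRatio_iff hr hz]
      exact (mul_le_mul_of_nonneg_left (hmax (Ioc_subset_Icc_self hz)) h0).trans_lt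
        ((lt_div_iff₀ hpos).1 hε)

/-! ### Threshold saturation -/

lemma mul_lam_le {y : ℝ} (hy : 0 ≤ y) :
    y * E.lam.eval y ≤ E.L.natDegree * E.varEnergy y := by
  rw [varEnergy, lam_eval, ← mul_div_assoc, ← mul_div_assoc]
  exact div_le_div_of_nonneg_right (mul_eval_derivative_le E.L_nonneg hy) E.varDegree_pos.le

/-- By `mul_lam_le` the error g f(g)/w is at most ε (deg L / w) V(g), so it is absorbed into ε at
the cost of a factor 1 + deg L / w. -/
lemma tendsto_coupledDE {E : LDPCEnsemble} (hr : 0 < E.designRate) {x ε : ℝ}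
    (hmax : IsMaxOn E.energyRatio (Icc 0 1) x) (hε : ε ∈ Icc (0 : ℝ) 1) {w : ℕ} (hw : 0 < w)
    (hlt : ε * (1 + E.L.natDegree / w) * E.energyRatio x < 1) (N : ℕ) :
    Tendsto (fun ℓ => E.coupledDE ε N w ℓ) atTop (𝓝 0) := by
  have hw' : (0 : ℝ) < w := by exact_mod_cast hw
  refine tendsto_coupledRecursion_zero (f := fun x => ε * E.lam.eval x) (g := E.checkMap) hw ?_
    E.mapsTo_checkMap ?_ E.monotoneOn_checkMap (continuous_const.mul E.lam.continuous)
    E.continuous_checkMap ?_ N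
  · intro y hy
    have h := eval_le_eval_of_coeff_nonneg E.lam_coeff_nonneg hy.1 hy.2
    rw [lam_eval_one] at h
    have h0 := eval_nonneg_of_coeff_nonneg E.lam_coeff_nonneg hy.1
    exact ⟨mul_nonneg hε.1 h0, mul_le_one₀ hε.2 h0 h⟩
  · exact fun y hy z _ hyz => mul_le_mul_of_nonneg_left
      (eval_le_eval_of_coeff_nonneg E.lam_coeff_nonneg hy.1 hyz) hε.1
  · intro X hX
    rw [integral_checkMap, integral_lam]
    have hd : 0 ≤ ε * (1 + E.L.natDegree / w) := mul_nonneg hε.1 (by positivity)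
    have h1 := (lt_one_div_energyRatio_iff hr hX).1
      ((mul_le_mul_of_nonneg_left (hmax (Ioc_subset_Icc_self hX)) hd).trans_lt hlt)
    refine lt_of_le_of_lt ?_ h1
    have h2 := mul_le_mul_of_nonneg_left (E.mul_lam_le (checkMap_pos hr hX).le) hε.1
    have h3 := div_le_div_of_nonneg_right h2 hw'.le
    refine le_trans (add_le_add_right (le_trans (le_of_eq ?_) h3) _) (le_of_eq ?_) <;> ring

lemma exists_coupling_width {ε M d : ℝ} (h : ε * M < 1) :
    ∃ w₀ : ℕ, ∀ w : ℕ, w₀ < w → ε * (1 + d / w) * M < 1 := by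
  have ht : Tendsto (fun w : ℕ => ε * (1 + d / w) * M) atTop (𝓝 (ε * (1 + 0) * M)) :=
    ((tendsto_const_nhds.add (tendsto_const_div_atTop_nhds_zero_nat d)).const_mul ε).mul_const M
  rw [add_zero, mul_one] at ht
  obtain ⟨w₀, hw₀⟩ := eventually_atTop.1 (ht.eventually_lt_const h)
  exact ⟨w₀, fun w hw => hw₀ w hw.le⟩

end LDPCEnsemble

theorem mainTheorem6 (E : LDPCEnsemble) (hr : 0 < E.designRate) :
    -- both thresholds are well defined
    IsLUB (zeroMinimizerParameters E.f E.g 1 1) E.epsC ∧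
    IsLeast E.maxwellCandidates E.maxwellThreshold ∧
    -- they coincide
    (E.epsC : EReal) = E.maxwellThreshold ∧
    -- below the Maxwell threshold, coupled density evolution converges to the zero vector
    ∀ ε ∈ Icc (0 : ℝ) 1, (ε : EReal) < E.maxwellThreshold →
      ∃ w₀ : ℕ, ∀ w : ℕ, w₀ < w → ∀ N : ℕ, 1 ≤ N →
        Tendsto (fun ℓ : ℕ => E.coupledDE ε N w ℓ) atTop (𝓝 0) := by
  obtain ⟨x, hx, hmax, h1⟩ := LDPCEnsemble.exists_isMaxOn_energyRatio hr
  have hleast := LDPCEnsemble.isLeast_maxwellCandidates hr hx hmax h1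
  have hM : E.maxwellThreshold = ((1 / E.energyRatio x : ℝ) : EReal) := by
    rw [E.maxwellThreshold_eq_sInf, hleast.isGLB.sInf_eq]
  have hlub := LDPCEnsemble.isLUB_epsC hr
  have heq : E.epsC = 1 / E.energyRatio x :=
    hlub.unique (LDPCEnsemble.isLUB_one_div_energyRatio hr hx hmax h1)
  rw [hM, heq]
  refine ⟨heq ▸ hlub, hleast, rfl, fun ε hε hlt => ?_⟩
  rw [EReal.coe_lt_coe_iff, lt_div_iff₀ (one_pos.trans h1)] at hlt
  obtain ⟨w₀, hw₀⟩ := LDPCEnsemble.exists_coupling_width (d := E.L.natDegree) hlt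
  exact ⟨w₀, fun w hw N _ => LDPCEnsemble.tendsto_coupledDE hr hmax hε (Nat.zero_lt_of_lt hw)
    (hw₀ w hw) N⟩
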